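/- Conventions. Identify a partition with its Young diagram (English notation; boxes are in rows and columns, rows weakly decreasing in length from top to bottom). For partitions $\lambda\subseteq\nu$, an increasing tableau of skew shape $\nu/\lambda$ is a filling of the boxes of $\nu\setminus\lambda$ by positive integers that strictly increases along each row (left to right) and down each column (the labels need not form an initial segment of $\{1,2,\dots\}$, and repeated labels are allowed). An inner corner is a maximally southeast box of $\lambda$, i.e. a box of $\lambda$ with no box of $\lambda$ immediately to its right or below. Given an increasing tableau $T$ of shape $\nu/\lambda$ and a nonempty set $X$ of inner corners, the $K$-jeu de taquin slide $K\mathrm{jdt}_X(T)$ is defined as follows. Put a symbol $\bullet$ in each box of $X$. For $i=1,2,\dots,\max T$ in turn, consider the boxes containing $\bullet$ or $i$ and their connected components (two boxes being adjacent if they share an edge); in every component with at least two boxes exchange the symbols $\bullet$ and $i$, and leave single-box components unchanged. After the last step delete the boxes containing $\bullet$; the remaining numbers form an increasing tableau $K\mathrm{jdt}_X(T)$ of shape $\nu'/(\lambda\setminus X)$, where $\nu'$ is $\nu$ with the final $\bullet$-boxes removed. A $K$-rectification of $T$ is any tableau of straight shape obtained from $T$ by applying successive slides, each at some nonempty set of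 inner corners of the current tableau, until no inner corner is left; the sequence of choices is called a rectification order. For a partition $\mu$, the superstandard tableau $S_\mu$ is the tableau of shape $\mu$ whose first row is $1,\dots,\mu_1$, whose second row is $\mu_1+1,\dots,\mu_1+\mu_2$, and so on. Theorem. Let $T$ be an increasing tableau of skew shape $\nu/\lambda$. If, for some rectification order, the $K$-rectification of $T$ is a superstandard tableau $S_\mu$, then for every rectification order the $K$-rectification of $T$ is $S_\mu$. -/

import Mathlib

/-- An increasing tableau of skew shape `outer / inner`: a filling of the boxes of
`outer` that are not in `inner` by positive integers, strictly increasing along each row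
and down each column.  Boxes are pairs `(row, column)`, indexed from `0`; `entry` is
normalised to be `0` off the skew shape. -/
@[ext]
structure IncTableau where
  outer : YoungDiagram
  inner : YoungDiagram
  inner_le : inner ≤ outer
  entry : ℕ × ℕ → ℕ
  entry_pos : ∀ x, x ∈ outer → x ∉ inner → 0 < entry x
  entry_off : ∀ x, (x ∉ outer ∨ x ∈ inner) → entry x = 0
  row_strict : ∀ i j₁ j₂ : ℕ, j₁ < j₂ → (i, j₁) ∉ inner → (i, j₂) ∈ outer →
    entry (i, j₁) < entry (i, j₂)
  col_strict : ∀ i₁ i₂ j : ℕ, i₁ < i₂ → (i₁, j) ∉ inner → (i₂, j) ∈ outer →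
    entry (i₁, j) < entry (i₂, j)

/-- The content of a box while a slide is being performed: the box is not in the
diagram (`blank`), or it holds a `•`, or it holds a number. -/
inductive Mark where
  | blank : Mark
  | bullet : Mark
  | label (n : ℕ) : Mark

namespace Mark

/-- The number in a box, `0` if there is none. -/
def num : Mark → ℕ
  | blank => 0
  | bullet => 0
  | label n => n

/-- Exchange the two symbols `•` and `i`. -/
def swap (i : ℕ) : Mark → Mark
  | blank => blank
  | bullet => label i
  | label n => if n = i then bullet else label n

/-- Auxiliary ranks for the proof that a slide yields an increasing tableau: after the
labels `1, …, i` have been processed, `•` behaves like the number `i + 1/2`. -/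
def rank (i : ℕ) : Mark → ℕ
  | blank => 0
  | bullet => 2 * i + 1
  | label n => 2 * n

end Mark

/-- Two boxes share an edge. -/
def BoxAdj (x y : ℕ × ℕ) : Prop :=
  (x.1 = y.1 ∧ (x.2 + 1 = y.2 ∨ y.2 + 1 = x.2)) ∨
    (x.2 = y.2 ∧ (x.1 + 1 = y.1 ∨ y.1 + 1 = x.1))

/-- The box `x` belongs to the union of short ribbons made of the boxes holding `•` or `i`. -/
def InRibbons (i : ℕ) (f : ℕ × ℕ → Mark) (x : ℕ × ℕ) : Prop :=
  f x = Mark.bullet ∨ f x = Mark.label i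

open Classical in
/-- Apply `switch` to the union of short ribbons made of the boxes holding `•` or `i`:
the two symbols are exchanged in every connected component with at least two boxes
(that is, in every box of the union that is adjacent to another one), and single-box
components, like all boxes outside the union, are left alone. -/
noncomputable def switchRibbons (i : ℕ) (f : ℕ × ℕ → Mark) : ℕ × ℕ → Mark := fun x =>
  if InRibbons i f x ∧ ∃ y, BoxAdj x y ∧ InRibbons i f y then (f x).swap i else f x

/-- Switch the `•`s successively past the labels `1, 2, …, m`. -/
noncomputable def sweep (f : ℕ × ℕ → Mark) : ℕ → (ℕ × ℕ → Mark)
  | 0 => f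
  | m + 1 => switchRibbons (m + 1) (sweep f m)

namespace IncTableau

/-- The inner corners of a tableau of shape `ν/λ`: the maximally southeast boxes of `λ`
(maximal for the componentwise order on boxes). -/
def IsInnerCorner (T : IncTableau) (x : ℕ × ℕ) : Prop :=
  Maximal (fun y => y ∈ T.inner) x

/-- The maximum entry of a tableau. -/
def maxEntry (T : IncTableau) : ℕ := T.outer.cells.sup T.entry

open Classical in
/-- The tableau with a `•` put in each of the boxes in `X`. -/
noncomputable def withBullets (T : IncTableau) (X : Finset (ℕ × ℕ)) : ℕ × ℕ → Mark := fun x =>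
  if x ∈ X then Mark.bullet
  else if x ∈ T.outer ∧ x ∉ T.inner then Mark.label (T.entry x)
  else Mark.blank

/-- The final placement, after the `•`s have been switched past all entries of `T`. -/
noncomputable def slideResult (T : IncTableau) (X : Finset (ℕ × ℕ)) : ℕ × ℕ → Mark :=
  sweep (T.withBullets X) T.maxEntry

theorem strict (T : IncTableau) {x y : ℕ × ℕ} (hxy : x < y) (hx : x ∉ T.inner)
    (hy : y ∈ T.outer) : T.entry x < T.entry y := by
  obtain ⟨a, b⟩ := x
  obtain ⟨c, d⟩ := y
  obtain ⟨⟨h1, h2⟩, hne⟩ := Prod.lt_iff.1 hxy |>.elim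
    (fun h => (⟨⟨h.1.le, h.2⟩, Or.inl h.1⟩ : (a ≤ c ∧ b ≤ d) ∧ (a < c ∨ b < d)))
    (fun h => ⟨⟨h.1, h.2.le⟩, Or.inr h.2⟩)
  have hm : (c, b) ∈ T.outer := T.outer.up_left_mem le_rfl h2 hy
  have hm' : (c, b) ∉ T.inner := fun h => hx (T.inner.up_left_mem h1 le_rfl h)
  rcases h1.eq_or_lt with rfl | h1
  · exact T.row_strict _ _ _ (by omega) hx hy
  · have := T.col_strict a c b h1 hx hm
    rcases h2.eq_or_lt with rfl | h2
    · exact this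
    · exact this.trans (T.row_strict _ _ _ h2 hm' hy)

/-- What holds of the partially switched filling after the labels `1, …, i` have been
processed; `m` bounds all labels. -/
structure SlideInv (T : IncTableau) (X : Finset (ℕ × ℕ)) (m i : ℕ) (f : ℕ × ℕ → Mark) :
    Prop where
  mem_iff : ∀ x, f x ≠ Mark.blank ↔ x ∈ T.outer ∧ (x ∈ T.inner → x ∈ X)
  bound : ∀ x n, f x = Mark.label n → 0 < n ∧ n ≤ m
  strict : ∀ x y, x < y → f x ≠ Mark.blank → f y ≠ Mark.blank →
    (f x).rank i < (f y).rank i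

theorem slideInv_zero (T : IncTableau) (X : Finset (ℕ × ℕ)) (hX : ∀ x ∈ X, T.IsInnerCorner x) :
    SlideInv T X T.maxEntry 0 (T.withBullets X) := by
  have key : ∀ x, T.withBullets X x ≠ Mark.blank →
      (x ∈ X ∧ T.withBullets X x = Mark.bullet) ∨
      (x ∈ T.outer ∧ x ∉ T.inner ∧ T.withBullets X x = Mark.label (T.entry x)) := by
    intro x hx
    unfold withBullets at hx ⊢
    split_ifs at hx ⊢ with h1 h2
    · exact Or.inl ⟨h1, rfl⟩
    · exact Or.inr ⟨h2.1, h2.2, rfl⟩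
    · exact absurd rfl hx
  refine ⟨?_, ?_, ?_⟩
  · intro x
    constructor
    · intro hx
      rcases key x hx with h | h
      · exact ⟨T.inner_le (hX x h.1).prop, fun _ => h.1⟩
      · exact ⟨h.1, fun h' => absurd h' h.2.1⟩
    · rintro ⟨h1, h2⟩
      unfold withBullets
      split_ifs with h3 h4
      · simp
      · simp
      · exact absurd (h2 (by by_contra h; exact h4 ⟨h1, h⟩)) h3
  · intro x n hn
    rcases key x (by simp [hn]) with h | h
    · rw [h.2] at hn; cases hn
    · rw [h.2.2] at hn
      cases hn
      exact ⟨T.entry_pos x h.1 h.2.1, Finset.le_sup (f := T.entry) h.1⟩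
  · intro x y hxy hx hy
    rcases key x hx with h | h <;> rcases key y hy with h' | h'
    · exact absurd ((hX x h.1).le_of_ge (hX y h'.1).prop hxy.le) (not_le_of_gt hxy)
    · have := T.entry_pos y h'.1 h'.2.1
      simp only [h.2, h'.2.2, Mark.rank]; omega
    · exact absurd (T.inner.isLowerSet hxy.le (hX y h'.1).prop) h.2.1
    · have := T.strict hxy h.2.1 h'.1
      simp only [h.2.2, h'.2.2, Mark.rank]; omega

theorem boxAdj_of_lt {x y : ℕ × ℕ} (hxy : x < y) (h : ∀ z, x < z → z < y → False) :
    BoxAdj x y := by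
  obtain ⟨a, b⟩ := x
  obtain ⟨c, d⟩ := y
  rcases Prod.lt_iff.1 hxy with ⟨h1, h2⟩ | ⟨h1, h2⟩
  · simp only at h1 h2
    by_cases he : a + 1 = c ∧ b = d
    · right; simp [he.1, he.2]
    · exact (h (a + 1, b) (Prod.lt_iff.2 (Or.inl ⟨by simp, le_rfl⟩))
        (Prod.lt_iff.2 (by simp only; omega))).elim
  · simp only at h1 h2
    by_cases he : b + 1 = d ∧ a = c
    · left; simp [he.1, he.2]
    · exact (h (a, b + 1) (Prod.lt_iff.2 (Or.inr ⟨le_rfl, by simp⟩))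
        (Prod.lt_iff.2 (by simp only; omega))).elim

theorem BoxAdj_symm {x y : ℕ × ℕ} (h : BoxAdj x y) : BoxAdj y x := by
  unfold BoxAdj at *; omega

theorem switch_cases (i : ℕ) (f : ℕ × ℕ → Mark) (x : ℕ × ℕ) :
    (f x = Mark.bullet ∧
      (switchRibbons i f x = Mark.bullet ∨ switchRibbons i f x = Mark.label i)) ∨
    (f x = Mark.label i ∧
      (switchRibbons i f x = Mark.bullet ∨ switchRibbons i f x = Mark.label i)) ∨
    (¬ InRibbons i f x ∧ switchRibbons i f x = f x) := by
  unfold switchRibbons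
  split_ifs with h
  · rcases h.1 with h' | h' <;> simp [h', Mark.swap]
  · by_cases hx : InRibbons i f x
    · rcases hx with h' | h' <;> simp [h']
    · exact Or.inr (Or.inr ⟨hx, rfl⟩)

theorem slideInv_succ (T : IncTableau) (X : Finset (ℕ × ℕ)) (m i : ℕ) (f : ℕ × ℕ → Mark)
    (hX : ∀ x ∈ X, T.IsInnerCorner x) (hi : i + 1 ≤ m) (h : SlideInv T X m i f) :
    SlideInv T X m (i + 1) (switchRibbons (i + 1) f) := by
  have hbl : ∀ x, switchRibbons (i + 1) f x ≠ Mark.blank ↔ f x ≠ Mark.blank := by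
    intro x
    rcases switch_cases (i + 1) f x with ⟨h1, h2 | h2⟩ | ⟨h1, h2 | h2⟩ | ⟨h1, h2⟩ <;>
      simp [h1, h2]
  refine ⟨fun x => (hbl x).trans (h.mem_iff x), ?_, ?_⟩
  · intro x n hn
    rcases switch_cases (i + 1) f x with ⟨h1, h2 | h2⟩ | ⟨h1, h2 | h2⟩ | ⟨h1, h2⟩
    · rw [h2] at hn; cases hn
    · rw [h2] at hn; cases hn; omega
    · rw [h2] at hn; cases hn
    · rw [h2] at hn; cases hn; omega
    · rw [h2] at hn; exact h.bound x n hn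
  · intro x y hxy hx hy
    rw [hbl] at hx hy
    have hs := h.strict x y hxy hx hy
    -- ranks before and after, for boxes inside and outside the ribbons
    have rin : ∀ z, InRibbons (i + 1) f z →
        (2 * i + 1 ≤ (f z).rank i ∧ (f z).rank i ≤ 2 * i + 2) ∧
        (2 * i + 2 ≤ (switchRibbons (i + 1) f z).rank (i + 1) ∧
          (switchRibbons (i + 1) f z).rank (i + 1) ≤ 2 * i + 3) := by
      intro z hz
      rcases switch_cases (i + 1) f z with ⟨h1, h2 | h2⟩ | ⟨h1, h2 | h2⟩ | ⟨h1, h2⟩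
      · simp only [h1, h2, Mark.rank]; omega
      · simp only [h1, h2, Mark.rank]; omega
      · simp only [h1, h2, Mark.rank]; omega
      · simp only [h1, h2, Mark.rank]; omega
      · exact absurd hz h1
    have rout : ∀ z, f z ≠ Mark.blank → ¬ InRibbons (i + 1) f z →
        (switchRibbons (i + 1) f z).rank (i + 1) = (f z).rank i ∧
        ((f z).rank i ≤ 2 * i ∨ 2 * i + 4 ≤ (f z).rank i) := by
      intro z hb hz
      have h2 : switchRibbons (i + 1) f z = f z := by
        unfold switchRibbons
        rw [if_neg (fun hh => hz hh.1)]
      rw [h2]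
      unfold InRibbons at hz
      cases hfz : f z with
      | blank => exact absurd hfz hb
      | bullet => exact absurd (Or.inl hfz) hz
      | label n =>
        have : n ≠ i + 1 := fun hn => hz (Or.inr (by rw [hfz, hn]))
        refine ⟨rfl, ?_⟩
        show 2 * n ≤ 2 * i ∨ 2 * i + 4 ≤ 2 * n
        omega
    by_cases hxR : InRibbons (i + 1) f x <;> by_cases hyR : InRibbons (i + 1) f y
    · have hadj : BoxAdj x y := by
        apply boxAdj_of_lt hxy
        intro z hxz hzy
        have hz : f z ≠ Mark.blank := by
          rw [h.mem_iff] at hx hy ⊢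
          refine ⟨T.outer.isLowerSet hzy.le hy.1, fun hzi => ?_⟩
          have hxi : x ∈ T.inner := T.inner.isLowerSet hxz.le hzi
          exact absurd ((hX x (hx.2 hxi)).le_of_ge hzi hxz.le) (not_le_of_gt hxz)
        have h1 := h.strict x z hxz hx hz
        have h2 := h.strict z y hzy hz hy
        have := rin x hxR
        have := rin y hyR
        omega
      have hx1 : switchRibbons (i + 1) f x = (f x).swap (i + 1) := by
        unfold switchRibbons
        rw [if_pos ⟨hxR, y, hadj, hyR⟩]
      have hy1 : switchRibbons (i + 1) f y = (f y).swap (i + 1) := by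
        unfold switchRibbons
        rw [if_pos ⟨hyR, x, BoxAdj_symm hadj, hxR⟩]
      rw [hx1, hy1]
      rcases hxR with e1 | e1 <;> rcases hyR with e2 | e2 <;>
        simp [e1, e2, Mark.rank, Mark.swap] at hs ⊢
    · have := rin x hxR; have := rout y hy hyR; omega
    · have := rin y hyR; have := rout x hx hxR; omega
    · have := rout x hx hxR; have := rout y hy hyR; omega

theorem slideInv_sweep (T : IncTableau) (X : Finset (ℕ × ℕ))
    (hX : ∀ x ∈ X, T.IsInnerCorner x) (i : ℕ) (hi : i ≤ T.maxEntry) :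
    SlideInv T X T.maxEntry i (sweep (T.withBullets X) i) := by
  induction i with
  | zero => exact T.slideInv_zero X hX
  | succ i ih => exact slideInv_succ T X _ i _ hX hi (ih (by omega))

theorem slideInv_result (T : IncTableau) (X : Finset (ℕ × ℕ))
    (hX : ∀ x ∈ X, T.IsInnerCorner x) :
    SlideInv T X T.maxEntry T.maxEntry (T.slideResult X) :=
  T.slideInv_sweep X hX _ le_rfl

theorem slideResult_label {T : IncTableau} {X : Finset (ℕ × ℕ)}
    (hX : ∀ x ∈ X, T.IsInnerCorner x) {x : ℕ × ℕ} (hx : x ∈ T.outer)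
    (hb : T.slideResult X x ≠ Mark.bullet) (hi : x ∈ T.inner → x ∈ X) :
    ∃ n, 0 < n ∧ T.slideResult X x = Mark.label n := by
  have h := T.slideInv_result X hX
  cases hfx : T.slideResult X x with
  | blank => exact absurd hfx ((h.mem_iff x).2 ⟨hx, hi⟩)
  | bullet => exact absurd hfx hb
  | label n => exact ⟨n, (h.bound x n hfx).1, rfl⟩

theorem slideResult_num_lt {T : IncTableau} {X : Finset (ℕ × ℕ)}
    (hX : ∀ x ∈ X, T.IsInnerCorner x) {x y : ℕ × ℕ} (hxy : x < y)
    (hx : x ∈ T.inner → x ∈ X) (hy : y ∈ T.outer) (hyb : T.slideResult X y ≠ Mark.bullet) :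
    T.slideResult X x ≠ Mark.bullet ∧
      (T.slideResult X x).num < (T.slideResult X y).num := by
  have h := T.slideInv_result X hX
  have hyi : y ∈ T.inner → y ∈ X := fun hyi => by
    have hxi : x ∈ T.inner := T.inner.isLowerSet hxy.le hyi
    exact absurd ((hX x (hx hxi)).le_of_ge hyi hxy.le) (not_le_of_gt hxy)
  have hs := h.strict x y hxy ((h.mem_iff x).2 ⟨T.outer.isLowerSet hxy.le hy, hx⟩)
    ((h.mem_iff y).2 ⟨hy, hyi⟩)
  obtain ⟨n, -, hn⟩ := slideResult_label hX hy hyb hyi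
  have hnm := (h.bound y n hn).2
  rw [hn] at hs ⊢
  cases hfx : T.slideResult X x with
  | blank => exact absurd hfx ((h.mem_iff x).2 ⟨T.outer.isLowerSet hxy.le hy, hx⟩)
  | bullet => rw [hfx] at hs; simp only [Mark.rank] at hs; omega
  | label k =>
    rw [hfx] at hs
    simp only [Mark.rank] at hs
    exact ⟨by simp, by simp only [Mark.num]; omega⟩

open Classical in
/-- The slide `Kjdt_X(T)` of `T` at a set `X` of inner corners.  The boxes in `X` leave the
inner shape, the boxes where a `•` ends up leave the outer shape, and the entries are the
final placement of the numbers. -/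
noncomputable def kjdt (T : IncTableau) (X : Finset (ℕ × ℕ))
    (hX : ∀ x ∈ X, T.IsInnerCorner x) : IncTableau where
  outer :=
    { cells := T.outer.cells.filter (fun x => T.slideResult X x ≠ Mark.bullet)
      isLowerSet := by
        intro y x hxy hy
        simp only [Finset.coe_filter, Set.mem_ofPred_eq, YoungDiagram.mem_cells] at hy ⊢
        refine ⟨T.outer.isLowerSet hxy hy.1, ?_⟩
        rcases hxy.eq_or_lt with rfl | hlt
        · exact hy.2
        · by_cases hx : x ∈ T.inner → x ∈ X
          · exact (slideResult_num_lt hX hlt hx hy.1 hy.2).1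
          · intro hb
            exact hx (((T.slideInv_result X hX).mem_iff x).1 (by simp [hb])).2 }
  inner :=
    { cells := T.inner.cells \ X
      isLowerSet := by
        intro y x hxy hy
        simp only [Finset.coe_sdiff, Set.mem_sdiff, Finset.mem_coe,
          YoungDiagram.mem_cells] at hy ⊢
        refine ⟨T.inner.isLowerSet hxy hy.1, fun hx => ?_⟩
        have : y = x := le_antisymm ((hX x hx).le_of_ge hy.1 hxy) hxy
        exact hy.2 (this ▸ hx) }
  inner_le := by
    intro x hx
    have hx' : x ∈ T.inner ∧ x ∉ X := by simpa [← YoungDiagram.mem_cells] using hx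
    suffices x ∈ T.outer ∧ T.slideResult X x ≠ Mark.bullet by
      simpa [← YoungDiagram.mem_cells] using this
    refine ⟨T.inner_le hx'.1, fun hb => ?_⟩
    exact hx'.2 ((((T.slideInv_result X hX).mem_iff x).1 (by simp [hb])).2 hx'.1)
  entry := fun x => (T.slideResult X x).num
  entry_pos := by
    intro x hx hx'
    simp only [← YoungDiagram.mem_cells, Finset.mem_filter, Finset.mem_sdiff, not_and,
      not_not] at hx hx'
    obtain ⟨n, hn, h⟩ := slideResult_label hX hx.1 hx.2 hx'
    rw [h]; exact hn
  entry_off := by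
    intro x hx
    simp only [← YoungDiagram.mem_cells, Finset.mem_filter, Finset.mem_sdiff] at hx
    cases hfx : T.slideResult X x with
    | blank => rfl
    | bullet => rfl
    | label n =>
      have := ((T.slideInv_result X hX).mem_iff x).1 (by simp [hfx])
      rcases hx with hx | hx
      · exact absurd ⟨this.1, by simp [hfx]⟩ hx
      · exact absurd (this.2 hx.1) hx.2
  row_strict := by
    intro i j₁ j₂ hj hx hy
    simp only [← YoungDiagram.mem_cells, Finset.mem_filter, Finset.mem_sdiff, not_and,
      not_not] at hx hy
    exact (slideResult_num_lt (x := (i, j₁)) (y := (i, j₂)) hX (Prod.lt_iff.2 (Or.inr ⟨le_rfl, hj⟩)) hx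
      hy.1 hy.2).2
  col_strict := by
    intro i₁ i₂ j hi hx hy
    simp only [← YoungDiagram.mem_cells, Finset.mem_filter, Finset.mem_sdiff, not_and,
      not_not] at hx hy
    exact (slideResult_num_lt (x := (i₁, j)) (y := (i₂, j)) hX (Prod.lt_iff.2 (Or.inl ⟨hi, le_rfl⟩)) hx
      hy.1 hy.2).2

/-- `IsKRect T R`: the tableau `R` is obtained from `T` by applying slides, each at some
nonempty set of inner corners, until no more slide is possible, that is, there is no inner
corner left.  A derivation of `IsKRect T R` is a rectification order. -/
inductive IsKRect : IncTableau → IncTableau → Prop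
  | done (T : IncTableau) (h : ∀ x, ¬ T.IsInnerCorner x) : IsKRect T T
  | slide (T R : IncTableau) (X : Finset (ℕ × ℕ)) (hne : X.Nonempty)
      (hX : ∀ x ∈ X, T.IsInnerCorner x) (h : IsKRect (T.kjdt X hX) R) : IsKRect T R

/-- No slide is possible exactly when the tableau has straight shape. -/
theorem no_innerCorner_iff (T : IncTableau) :
    (∀ x, ¬ T.IsInnerCorner x) ↔ T.inner = ⊥ := by
  constructor
  · intro h
    by_contra hne
    have hn : T.inner.cells.Nonempty := by
      rw [Finset.nonempty_iff_ne_empty]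
      intro he
      exact hne (YoungDiagram.ext he)
    obtain ⟨x, hx⟩ := T.inner.cells.exists_maximal hn
    exact h x hx
  · intro h x hx
    have := hx.prop
    rw [h] at this
    exact YoungDiagram.notMem_bot x this

/-- The superstandard tableau `S_μ`: the first row is filled with `1, …, μ₁`, the second
with `μ₁ + 1, …, μ₁ + μ₂`, and so on. -/
def superstandard (μ : YoungDiagram) : IncTableau where
  outer := μ
  inner := ⊥
  inner_le := bot_le
  entry := fun x => if x ∈ μ then (∑ k ∈ Finset.range x.1, μ.rowLen k) + x.2 + 1 else 0
  entry_pos := by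
    intro x hx _
    rw [if_pos hx]; omega
  entry_off := by
    intro x hx
    rcases hx with hx | hx
    · rw [if_neg hx]
    · exact absurd hx (YoungDiagram.notMem_bot x)
  row_strict := by
    intro i j₁ j₂ hj _ hy
    rw [if_pos hy, if_pos (μ.up_left_mem le_rfl hj.le hy)]
    simp only
    omega
  col_strict := by
    intro i₁ i₂ j hi _ hy
    have hx : (i₁, j) ∈ μ := μ.up_left_mem hi.le le_rfl hy
    rw [if_pos hy, if_pos hx]
    have h1 : j < μ.rowLen i₁ := YoungDiagram.mem_iff_lt_rowLen.1 hx
    have h2 : ∑ k ∈ Finset.range (i₁ + 1), μ.rowLen k ≤ ∑ k ∈ Finset.range i₂, μ.rowLen k :=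
      Finset.sum_le_sum_of_subset (Finset.range_mono hi)
    rw [Finset.sum_range_succ] at h2
    simp only
    omega

end IncTableau

/-! For any interval of labels, consider chains of boxes with labels in it that increase strictly
while going strictly east and weakly north. Which lengths occur is invariant under slides, as is the
transposed statement (`IsKRect.sameChains`). So all rectifications of one tableau have the same
chain lengths, and these determine a straight tableau once they agree with those of a superstandard
one (`eq_superstandard_of_sameChains`).

Invariance is proved one label at a time. Switching can turn a label of a chain into a bullet;
usually the label reappears next to it and repairs the chain. The obstruction is a label moving up
out of a row in which the chain continues. The lost chain is then remembered as an `IsBrokenChain`: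
were the bullet `w` labelled, `D'`, `w`, `U` would be a chain of length `k`; as a substitute, `D`
with `u` is one longer than `D'`. This state persists until a chain of length `k` is restored
(`chain_step`, `broken_step`). When no labels remain beyond the bullets, `U` is empty and `D` with
`u` already has length `k`. The converse comes from rotating by 180° and reversing time
(`SwitchStep.rotate`).

To recognise `S_μ`, row chains give the lengths and entries of the rows one after another, and
column chains of length two keep the labels of one row from spilling into lower rows. -/

/-- One step of a slide, in terms of ranks: a label `n` has rank `2 * n`, and the bullets have
rank `e - 1` before and `e + 1` after they are switched past the label of rank `e`. -/
structure SwitchStep {α : Type*} (row col : α → ℤ) (S : Set α) (ρ σ : α → ℤ) (e : ℤ) : Prop where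
  even : Even e
  convex : ∀ x ∈ S, ∀ y ∈ S, ∀ i j, row x ≤ i → i ≤ row y → col x ≤ j → j ≤ col y →
    ∃ z ∈ S, row z = i ∧ col z = j
  strict_before : ∀ x ∈ S, ∀ y ∈ S, row x ≤ row y → col x ≤ col y → x = y ∨ ρ x < ρ y
  strict_after : ∀ x ∈ S, ∀ y ∈ S, row x ≤ row y → col x ≤ col y → x = y ∨ σ x < σ y
  fixed : ∀ x ∈ S, ρ x ≠ e - 1 → ρ x ≠ e → σ x = ρ x ∧ Even (ρ x)
  moved : ∀ x ∈ S, ρ x = e - 1 ∨ ρ x = e → σ x = e ∨ σ x = e + 1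
  bullet_before : ∀ x ∈ S, ρ x = e → σ x = e + 1 → ∃ z ∈ S, ρ z = e - 1 ∧
    ((row z = row x - 1 ∧ col z = col x) ∨ (row z = row x ∧ col z = col x - 1))
  bullet_after : ∀ x ∈ S, ρ x = e - 1 → σ x = e → ∃ z ∈ S, σ z = e + 1 ∧
    ((row z = row x + 1 ∧ col z = col x) ∨ (row z = row x ∧ col z = col x + 1))

/-- A list of labelled boxes with ranks between `a` and `b`, going strictly east and weakly
north, whose ranks strictly increase. -/
def IsRankChain {α : Type*} (row col : α → ℤ) (S : Set α) (a b : ℤ) (ρ : α → ℤ)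
    (l : List α) : Prop :=
  l.Pairwise (fun x y => col x < col y ∧ row y ≤ row x ∧ ρ x < ρ y) ∧
    ∀ x ∈ l, x ∈ S ∧ Even (ρ x) ∧ a ≤ ρ x ∧ ρ x ≤ b

/-- A chain of length `k` that is broken at the bullet `w`: the upper part `U` continues `w`;
the lower part `D` ends at the box above `w`, and `D'` is one shorter and continues to `w`. -/
def IsBrokenChain {α : Type*} (row col : α → ℤ) (S : Set α) (a b : ℤ) (ρ : α → ℤ)
    (β : ℤ) (k : ℕ) : Prop :=
  ∃ w ∈ S, ρ w = β ∧ ∃ (u : α) (D D' U : List α),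
    IsRankChain row col S a b ρ (D ++ [u]) ∧ IsRankChain row col S a b ρ D' ∧
    IsRankChain row col S a b ρ U ∧ D'.length = D.length ∧ D.length + 1 + U.length = k ∧
    row u = row w - 1 ∧ col u = col w ∧ ρ u < β ∧
    (∀ x ∈ D', ρ x < β ∧ col x < col w ∧ row w ≤ row x) ∧
    (∀ x ∈ U, β < ρ x ∧ col w < col x ∧ row x ≤ row w)

section

variable {α : Type*} {row col : α → ℤ} {S : Set α} {a b e β : ℤ} {ρ σ : α → ℤ} {k : ℕ}

theorem IsRankChain.congr {S' : Set α} {l : List α} (h : IsRankChain row col S a b ρ l)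
    (hS : ∀ x ∈ l, x ∈ S') (hρ : ∀ x ∈ l, σ x = ρ x) : IsRankChain row col S' a b σ l := by
  refine ⟨h.1.imp_of_mem ?_, fun x hx => ?_⟩
  · intro x y hx hy hxy
    rw [hρ x hx, hρ y hy]; exact hxy
  · rw [hρ x hx]; exact ⟨hS x hx, (h.2 x hx).2⟩

theorem IsRankChain.append {l₁ l₂ : List α} (h₁ : IsRankChain row col S a b ρ l₁)
    (h₂ : IsRankChain row col S a b ρ l₂)
    (h : ∀ x ∈ l₁, ∀ y ∈ l₂, col x < col y ∧ row y ≤ row x ∧ ρ x < ρ y) :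
    IsRankChain row col S a b ρ (l₁ ++ l₂) := by
  refine ⟨List.pairwise_append.2 ⟨h₁.1, h₂.1, h⟩, fun x hx => ?_⟩
  rcases List.mem_append.1 hx with hx | hx
  · exact h₁.2 x hx
  · exact h₂.2 x hx

theorem isRankChain_append_iff {l₁ l₂ : List α} : IsRankChain row col S a b ρ (l₁ ++ l₂) ↔
    IsRankChain row col S a b ρ l₁ ∧ IsRankChain row col S a b ρ l₂ ∧
      ∀ x ∈ l₁, ∀ y ∈ l₂, col x < col y ∧ row y ≤ row x ∧ ρ x < ρ y := by
  refine ⟨fun h => ?_, fun h => h.1.append h.2.1 h.2.2⟩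
  have := List.pairwise_append.1 h.1
  exact ⟨⟨this.1, fun x hx => h.2 x (by simp [hx])⟩, ⟨this.2.1, fun x hx => h.2 x (by simp [hx])⟩,
    this.2.2⟩

theorem isRankChain_singleton_iff {x : α} : IsRankChain row col S a b ρ [x] ↔
    x ∈ S ∧ Even (ρ x) ∧ a ≤ ρ x ∧ ρ x ≤ b := by
  simp [IsRankChain]

/-! ### Effect of one switch on chains -/

namespace SwitchStep

variable (h : SwitchStep row col S ρ σ e)
include h

theorem eq_of_even {x : α} (hx : x ∈ S) (hev : Even (ρ x)) (hne : ρ x ≠ e) : σ x = ρ x := by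
  refine (h.fixed x hx ?_ hne).1
  intro h1
  have := h.even
  rw [h1] at hev
  grind

theorem chain_of_ne {l : List α} (hl : IsRankChain row col S a b ρ l)
    (hne : ∀ x ∈ l, ρ x ≠ e) : IsRankChain row col S a b σ l :=
  hl.congr (fun x hx => (hl.2 x hx).1)
    fun x hx => h.eq_of_even (hl.2 x hx).1 (hl.2 x hx).2.1 (hne x hx)

/-- Only a chain member `v` of rank `e` can be disturbed, and only if it becomes a bullet. Its label
then also appears at a neighbouring former bullet `z`, which replaces `v` unless `z` lies above `v`
and the chain continues in the row of `v`. -/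
theorem chain_step {l : List α} (hl : IsRankChain row col S a b ρ l) (hk : l.length = k) :
    (∃ l, IsRankChain row col S a b σ l ∧ l.length = k) ∨
      IsBrokenChain row col S a b σ (e + 1) k := by
  by_cases hex : ∃ x ∈ l, ρ x = e
  swap
  · push Not at hex
    exact Or.inl ⟨l, h.chain_of_ne hl hex, hk⟩
  obtain ⟨v, hv, hve⟩ := hex
  obtain ⟨L, U, rfl⟩ := List.append_of_mem hv
  rw [← List.singleton_append] at hl
  obtain ⟨hL, hvU, hLvU⟩ := isRankChain_append_iff.1 hl
  obtain ⟨hv1, hU, hvU⟩ := isRankChain_append_iff.1 hvU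
  have hvS := (isRankChain_singleton_iff.1 hv1).1
  have hLv : ∀ x ∈ L, col x < col v ∧ row v ≤ row x ∧ ρ x < e := fun x hx => by
    rw [← hve]; exact hLvU x hx v (by simp)
  have hvU : ∀ y ∈ U, col v < col y ∧ row y ≤ row v ∧ e < ρ y := fun y hy => by
    rw [← hve]; exact hvU v (by simp) y hy
  have hLs : ∀ x ∈ L, σ x = ρ x := fun x hx =>
    h.eq_of_even (hL.2 x hx).1 (hL.2 x hx).2.1 (by have := hLv x hx; omega)
  have hUs : ∀ x ∈ U, σ x = ρ x := fun x hx =>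
    h.eq_of_even (hU.2 x hx).1 (hU.2 x hx).2.1 (by have := hvU x hx; omega)
  have hL' := h.chain_of_ne hL (fun x hx => by have := hLv x hx; omega)
  have hU' := h.chain_of_ne hU (fun x hx => by have := hvU x hx; omega)
  have hbd := (isRankChain_singleton_iff.1 hv1).2
  rw [hve] at hbd
  have hjoin : ∀ z ∈ S, σ z = e → (∀ x ∈ L, col x < col z ∧ row z ≤ row x) →
      (∀ y ∈ U, col z < col y ∧ row y ≤ row z) →
      ∃ l, IsRankChain row col S a b σ l ∧ l.length = k := by
    intro z hz hze h1 h2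
    refine ⟨L ++ ([z] ++ U), hL'.append (IsRankChain.append
      (isRankChain_singleton_iff.2 ⟨hz, hze ▸ hbd⟩) hU' ?_) ?_, by simpa using hk⟩
    · intro x hx y hy
      obtain rfl := List.mem_singleton.1 hx
      rw [hze, hUs y hy]
      exact ⟨(h2 y hy).1, (h2 y hy).2, (hvU y hy).2.2⟩
    · intro x hx y hy
      rw [hLs x hx]
      rcases List.mem_append.1 hy with hy | hy
      · obtain rfl := List.mem_singleton.1 hy
        rw [hze]
        exact ⟨(h1 x hx).1, (h1 x hx).2, (hLv x hx).2.2⟩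
      · rw [hUs y hy]
        exact hLvU x hx y (by simp [hy])
  rcases h.moved v hvS (Or.inr hve) with hvs | hvs
  · exact Or.inl (hjoin v hvS hvs (fun x hx => ⟨(hLv x hx).1, (hLv x hx).2.1⟩)
      fun y hy => ⟨(hvU y hy).1, (hvU y hy).2.1⟩)
  obtain ⟨z, hz, hzr, hzp⟩ := h.bullet_before v hvS hve hvs
  have hzs : σ z = e := by
    have h1 := h.moved z hz (Or.inl hzr)
    rcases h.strict_after z hz v hvS (by omega) (by omega) with h2 | h2
    · subst h2; omega
    · omega
  rcases hzp with ⟨hz1, hz2⟩ | ⟨hz1, hz2⟩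
  · by_cases hrow : ∀ y ∈ U, row y ≤ row z
    · refine Or.inl (hjoin z hz hzs (fun x hx => ?_) fun y hy => ⟨?_, hrow y hy⟩)
      · have := hLv x hx; omega
      · have := hvU y hy; omega
    -- Some box of `U` lies below the row of `z`, so `z` cannot precede `U`. The chain breaks at
    -- `v`, with `u = z` and both lower parts equal to `L`.
    · refine Or.inr ⟨v, hvS, hvs, z, L, L, U, hL'.append
        (isRankChain_singleton_iff.2 ⟨hz, hzs ▸ hbd⟩) ?_, hL', hU', rfl, ?_, hz1, hz2, by omega,
        fun x hx => ?_, fun y hy => ?_⟩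
      · intro x hx y hy
        obtain rfl := List.mem_singleton.1 hy
        have := hLv x hx
        rw [hLs x hx]; omega
      · simp at hk; omega
      · have := hLv x hx
        rw [hLs x hx]; omega
      · have := hvU y hy
        have hev := (hU.2 y hy).2.1
        have := h.even
        -- Labels have even rank and bullets odd rank, so `e < ρ y` improves to `e + 1 < ρ y`.
        have : ρ y ≠ e + 1 := by rintro h1; rw [h1] at hev; grind
        rw [hUs y hy]; omega
  · refine Or.inl (hjoin z hz hzs (fun x hx => ?_) fun y hy => ?_)
    · have h1 := hLv x hx
      -- Otherwise `x` is weakly below the bullet `z` in the same column, and its rank would lie in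
      -- the open interval from `e - 1` to `e` or be odd.
      refine ⟨?_, by omega⟩
      by_contra hc
      rcases h.strict_before z hz x (hL.2 x hx).1 (by omega) (by omega) with h2 | h2
      · have hev := (hL.2 x hx).2.1
        have := h.even
        rw [← h2, hzr] at hev
        grind
      · omega
    · have := hvU y hy; omega

/-- The first box `v` of `U` decides. If `U` is empty or `v` lies above the row of `w`, then `D`,
`u`, `U` is an ordinary chain. If `v` is in that row with rank `e`, the break moves one column
right, from `w` to `v`. If its rank is larger, either `w` acquires a label and completes `D'`, `w`,
`U`, or the break stays at `w`. -/
theorem broken_step (hb : IsBrokenChain row col S a b ρ (e - 1) k) :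
    (∃ l, IsRankChain row col S a b σ l ∧ l.length = k) ∨
      IsBrokenChain row col S a b σ (e + 1) k := by
  obtain ⟨w, hw, hwe, u, D, D', U, hD, hD', hU, hlen, hk, hu1, hu2, hue, hD'w, hUw⟩ := hb
  obtain ⟨hD1, hu, hDu⟩ := isRankChain_append_iff.1 hD
  have hu := isRankChain_singleton_iff.1 hu
  have hDu : ∀ x ∈ D, col x < col u ∧ row u ≤ row x ∧ ρ x < ρ u := fun x hx => hDu x hx u (by simp)
  have hDe : ∀ x ∈ D ++ [u], ρ x < e - 1 ∧ col x ≤ col w ∧ row w - 1 ≤ row x := by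
    intro x hx
    rcases List.mem_append.1 hx with hx | hx
    · have := hDu x hx; omega
    · obtain rfl := List.mem_singleton.1 hx; omega
  have hDs : ∀ x ∈ D ++ [u], σ x = ρ x := fun x hx =>
    h.eq_of_even (hD.2 x hx).1 (hD.2 x hx).2.1 (by have := hDe x hx; omega)
  have hD's : ∀ x ∈ D', σ x = ρ x := fun x hx =>
    h.eq_of_even (hD'.2 x hx).1 (hD'.2 x hx).2.1 (by have := hD'w x hx; omega)
  have hDc := h.chain_of_ne hD (fun x hx => by have := hDe x hx; omega)
  have hD'c := h.chain_of_ne hD' (fun x hx => by have := hD'w x hx; omega)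
  by_cases hrow : ∀ y ∈ U, row y ≤ row w - 1
  · refine h.chain_step (hD.append hU fun x hx y hy => ?_) (by simp at hk ⊢; omega)
    have := hDe x hx
    have := hUw y hy
    have := hrow y hy
    omega
  push Not at hrow
  obtain ⟨y, hy, hyr⟩ := hrow
  obtain _ | ⟨v, U⟩ := U
  · simp at hy
  rw [← List.singleton_append] at hU
  obtain ⟨hv, hU, hvU⟩ := isRankChain_append_iff.1 hU
  have hv := isRankChain_singleton_iff.1 hv
  have hvU : ∀ y ∈ U, col v < col y ∧ row y ≤ row v ∧ ρ v < ρ y := hvU v (by simp)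
  have hvw := hUw v (by simp)
  -- Rows weakly decrease along `U`, so if any of its boxes is in the row of `w`, the first one is.
  have hvr : row v = row w := by
    rcases List.mem_cons.1 hy with rfl | hy
    · omega
    · have := hvU y hy; omega
  have hUe : ∀ y ∈ U, e + 1 < ρ y := fun y hy => by
    have h1 := hvU y hy
    have hev := (hU.2 y hy).2.1
    have := h.even
    have : ρ y ≠ e + 1 := by rintro h1; rw [h1] at hev; grind
    omega
  have hUs : ∀ x ∈ U, σ x = ρ x := fun x hx =>
    h.eq_of_even (hU.2 x hx).1 (hU.2 x hx).2.1 (by have := hUe x hx; omega)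
  have hUc := h.chain_of_ne hU (fun x hx => by have := hUe x hx; omega)
  have hvU1 : IsRankChain row col S a b ρ ([v] ++ U) :=
    IsRankChain.append (isRankChain_singleton_iff.2 hv) hU (by simpa using hvU)
  have hws := h.moved w hw (Or.inl hwe)
  -- A new label of rank `e` stays in the interval because `ρ u < e ≤ ρ v`.
  have hab : a ≤ e ∧ e ≤ b := by have := hu.2.2; have := hv.2.2; omega
  have hD'w' : σ w = e → IsRankChain row col S a b σ (D' ++ [w]) := fun hws =>
    hD'c.append (isRankChain_singleton_iff.2 ⟨hw, hws ▸ ⟨h.even, hab⟩⟩) (by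
      intro x hx y hy
      obtain rfl := List.mem_singleton.1 hy
      have := hD'w x hx
      rw [hD's x hx]; omega)
  by_cases hve : ρ v = e
  · -- the box `v` is directly to the right of `w`
    have hvc : col v = col w + 1 := by
      by_contra hc
      obtain ⟨z, hz, hz1, hz2⟩ := h.convex w hw v hv.1 (row w) (col w + 1) (by omega) (by omega)
        (by omega) (by omega)
      rcases h.strict_before w hw z hz (by omega) (by omega) with h1 | h1
      · subst h1; omega
      rcases h.strict_before z hz v hv.1 (by omega) (by omega) with h2 | h2
      · subst h2; omega
      omega
    have hvs := h.moved v hv.1 (Or.inr hve)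
    have hwv : σ w = e ∧ σ v = e + 1 := by
      rcases h.strict_after w hw v hv.1 (by omega) (by omega) with h1 | h1
      · subst h1; omega
      omega
    -- The box `x` right of `u` and above `v` becomes the new `u`. After the switch it is squeezed
    -- between `u` and the bullet at `v`, hence labelled. Both lower parts grow by one, `D` with `u`
    -- by `x` and `D'` by `w`, while `U` loses `v`.
    obtain ⟨x, hx, hx1, hx2⟩ := h.convex u hu.1 v hv.1 (row w - 1) (col w + 1) (by omega)
      (by omega) (by omega) (by omega)
    have hxu : σ u < σ x := by
      rcases h.strict_after u hu.1 x hx (by omega) (by omega) with h1 | h1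
      · subst h1; omega
      exact h1
    have hxv : ρ x < e := by
      rcases h.strict_before x hx v hv.1 (by omega) (by omega) with h1 | h1
      · subst h1; omega
      omega
    have hxv' : σ x < e + 1 := by
      rcases h.strict_after x hx v hv.1 (by omega) (by omega) with h1 | h1
      · subst h1; omega
      omega
    have hxev : Even (σ x) := by
      by_cases h1 : ρ x = e - 1
      · have := h.moved x hx (Or.inl h1)
        rw [show σ x = e by omega]; exact h.even
      · have := h.fixed x hx h1 (by omega)
        rw [this.1]; exact this.2
    have hus : σ u = ρ u := hDs u (by simp)
    have hDx : IsRankChain row col S a b σ ((D ++ [u]) ++ [x]) := by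
      refine hDc.append (isRankChain_singleton_iff.2 ⟨hx, hxev, by omega, by omega⟩) ?_
      intro y hy z hz
      obtain rfl := List.mem_singleton.1 hz
      have h1 := hDe y hy
      refine ⟨by omega, by omega, ?_⟩
      rcases List.mem_append.1 hy with hy' | hy'
      · rw [hDs y hy]
        have := hDu y hy'
        omega
      · obtain rfl := List.mem_singleton.1 hy'
        exact hxu
    refine Or.inr ⟨v, hv.1, hwv.2, x, D ++ [u], D' ++ [w], U, hDx, hD'w' hwv.1, hUc,
      by simp [hlen], by simp at hk ⊢; omega, by omega, by omega, hxv', ?_, ?_⟩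
    · intro y hy
      rcases List.mem_append.1 hy with hy | hy
      · rw [hD's y hy]
        have := hD'w y hy
        omega
      · obtain rfl := List.mem_singleton.1 hy
        omega
    · intro y hy
      rw [hUs y hy]
      exact ⟨hUe y hy, (hvU y hy).1, (hvU y hy).2.1⟩
  · have hve' : e + 1 < ρ v := by
      have hev := hv.2.1
      have := h.even
      have : ρ v ≠ e + 1 := by rintro h1; rw [h1] at hev; grind
      omega
    have hvUe : ∀ y ∈ [v] ++ U, e + 1 < ρ y := by
      intro y hy
      rcases List.mem_append.1 hy with hy | hy
      · obtain rfl := List.mem_singleton.1 hy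
        exact hve'
      · exact hUe y hy
    have hvUs : ∀ y ∈ [v] ++ U, σ y = ρ y := fun y hy =>
      h.eq_of_even (hvU1.2 y hy).1 (hvU1.2 y hy).2.1 (by have := hvUe y hy; omega)
    have hvUc := h.chain_of_ne hvU1 (fun x hx => by have := hvUe x hx; omega)
    rcases hws with hws | hws
    · refine Or.inl ⟨(D' ++ [w]) ++ ([v] ++ U), (hD'w' hws).append hvUc ?_,
        by simp at hk ⊢; omega⟩
      intro x hx y hy
      have h1 := hUw y hy
      have h2 := hvUe y hy
      rw [hvUs y hy]
      rcases List.mem_append.1 hx with hx | hx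
      · have := hD'w x hx
        rw [hD's x hx]
        omega
      · obtain rfl := List.mem_singleton.1 hx
        omega
    · refine Or.inr ⟨w, hw, hws, u, D, D', [v] ++ U, hDc, hD'c, hvUc, hlen, by simpa using hk,
        hu1, hu2, by have := hDs u (by simp); omega, fun x hx => ?_, fun y hy => ?_⟩
      · rw [hD's x hx]
        have := hD'w x hx
        omega
      · rw [hvUs y hy]
        exact ⟨hvUe y hy, (hUw y hy).2⟩

/-! ### Symmetries and whole sequences of switches -/

/-- Undoing a switch is a switch on the rotated picture: the bullet rank `e + 1` becomes `-e - 1`,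
the bullet rank before a switch at `-e`. This supplies the backward direction of invariance. -/
theorem rotate : SwitchStep (-row) (-col) S (-σ) (-ρ) (-e) where
  even := h.even.neg
  convex x hx y hy i j h1 h2 h3 h4 := by
    simp only [Pi.neg_apply] at *
    obtain ⟨z, hz, h5, h6⟩ := h.convex y hy x hx (-i) (-j) (by omega) (by omega) (by omega)
      (by omega)
    exact ⟨z, hz, by omega, by omega⟩
  strict_before x hx y hy h1 h2 := by
    simp only [Pi.neg_apply] at *
    have := h.strict_after y hy x hx (by omega) (by omega)
    exact this.imp Eq.symm (by omega)
  strict_after x hx y hy h1 h2 := by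
    simp only [Pi.neg_apply] at *
    have := h.strict_before y hy x hx (by omega) (by omega)
    exact this.imp Eq.symm (by omega)
  fixed x hx h1 h2 := by
    simp only [Pi.neg_apply] at *
    have h3 := h.moved x hx
    have h4 := h.fixed x hx (by omega) (by omega)
    rw [h4.1]
    exact ⟨rfl, h4.2.neg⟩
  moved x hx h1 := by
    simp only [Pi.neg_apply] at *
    by_contra hc
    have h4 := h.fixed x hx (by omega) (by omega)
    have h5 : ρ x = e + 1 := by omega
    have := h.even
    have h6 := h4.2
    rw [h5] at h6
    grind
  bullet_before x hx h1 h2 := by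
    simp only [Pi.neg_apply] at *
    obtain ⟨z, hz, h3, h4⟩ := h.bullet_after x hx (by omega) (by omega)
    exact ⟨z, hz, by omega, by omega⟩
  bullet_after x hx h1 h2 := by
    simp only [Pi.neg_apply] at *
    obtain ⟨z, hz, h3, h4⟩ := h.bullet_before x hx (by omega) (by omega)
    exact ⟨z, hz, by omega, by omega⟩

theorem transpose : SwitchStep col row S ρ σ e where
  even := h.even
  convex x hx y hy i j h1 h2 h3 h4 := by
    obtain ⟨z, hz, h5, h6⟩ := h.convex x hx y hy j i h3 h4 h1 h2
    exact ⟨z, hz, h6, h5⟩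
  strict_before x hx y hy h1 h2 := h.strict_before x hx y hy h2 h1
  strict_after x hx y hy h1 h2 := h.strict_after x hx y hy h2 h1
  fixed := h.fixed
  moved := h.moved
  bullet_before x hx h1 h2 := by
    obtain ⟨z, hz, h3, h4⟩ := h.bullet_before x hx h1 h2
    exact ⟨z, hz, h3, by omega⟩
  bullet_after x hx h1 h2 := by
    obtain ⟨z, hz, h3, h4⟩ := h.bullet_after x hx h1 h2
    exact ⟨z, hz, h3, by omega⟩

end SwitchStep

theorem IsRankChain.rotate {l : List α} (h : IsRankChain row col S a b ρ l) :
    IsRankChain (-row) (-col) S (-b) (-a) (-ρ) l.reverse := by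
  refine ⟨List.pairwise_reverse.2 (h.1.imp fun {x y} hxy => ?_), fun x hx => ?_⟩
  · simp only [Pi.neg_apply]; omega
  · have := h.2 x (List.mem_reverse.1 hx)
    simp only [Pi.neg_apply]
    exact ⟨this.1, this.2.1.neg, by omega, by omega⟩

/-- A box of `U` would carry a label beyond the bullets, so `U` is empty and `D` with `u` has full
length. -/
theorem IsBrokenChain.exists_chain (h : IsBrokenChain row col S a b ρ β k)
    (hβ : ∀ x ∈ S, Even (ρ x) → ρ x < β) :
    ∃ l, IsRankChain row col S a b ρ l ∧ l.length = k := by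
  obtain ⟨w, hw, hwe, u, D, D', U, hD, hD', hU, hlen, hk, -, -, -, -, hUw⟩ := h
  obtain _ | ⟨v, U⟩ := U
  · exact ⟨_, hD, by simpa using hk⟩
  · have h1 := hU.2 v (by simp)
    have h2 := hUw v (by simp)
    have := hβ v h1.1 h1.2.1
    omega

theorem exists_rankChain_forward {m : ℕ} {ρ : ℕ → α → ℤ} {c : ℤ}
    (h : ∀ i < m, SwitchStep row col S (ρ i) (ρ (i + 1)) (c + 2 * i))
    (hm : ∀ x ∈ S, Even (ρ m x) → ρ m x < c + 2 * m - 1)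
    (hl : ∃ l, IsRankChain row col S a b (ρ 0) l ∧ l.length = k) :
    ∃ l, IsRankChain row col S a b (ρ m) l ∧ l.length = k := by
  have key : ∀ i ≤ m, (∃ l, IsRankChain row col S a b (ρ i) l ∧ l.length = k) ∨
      IsBrokenChain row col S a b (ρ i) (c + 2 * i - 1) k := by
    intro i
    induction i with
    | zero => exact fun _ => Or.inl hl
    | succ i ih =>
      intro hi
      have hs := h i (by omega)
      rw [show c + 2 * ((i + 1 : ℕ) : ℤ) - 1 = c + 2 * i + 1 by push_cast; ring]
      rcases ih (by omega) with ⟨l, hl, hk⟩ | hb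
      · exact hs.chain_step hl hk
      · exact hs.broken_step hb
  rcases key m le_rfl with h1 | h1
  · exact h1
  · exact h1.exists_chain hm

theorem exists_rankChain_iff {m : ℕ} {ρ : ℕ → α → ℤ}
    (h : ∀ i < m, SwitchStep row col S (ρ i) (ρ (i + 1)) (2 + 2 * i))
    (h0 : ∀ x ∈ S, Even (ρ 0 x) → 1 < ρ 0 x)
    (hm : ∀ x ∈ S, Even (ρ m x) → ρ m x < 2 * m + 1) :
    (∃ l, IsRankChain row col S a b (ρ 0) l ∧ l.length = k) ↔
    ∃ l, IsRankChain row col S a b (ρ m) l ∧ l.length = k := by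
  refine ⟨exists_rankChain_forward h fun x hx hev => ?_, fun ⟨l, hl, hk⟩ => ?_⟩
  · have := hm x hx hev; omega
  -- Reversed step `i` is original step `m - 1 - i`, at rank `-(2 + 2 * (m - 1 - i)) = -(2 * m) + 2
  -- * i`; this fixes `c`.
  · obtain ⟨l', hl', hk'⟩ := exists_rankChain_forward (m := m) (ρ := fun i => -ρ (m - i))
      (c := -(2 * m)) (row := -row) (col := -col) (a := -b) (b := -a) (S := S) (k := k)
      (fun i hi => by
        have h1 := (h (m - (i + 1)) (by omega)).rotate
        rw [show m - (i + 1) + 1 = m - i by omega] at h1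
        convert h1 using 1
        omega)
      (fun x hx hev => by
        simp only [Nat.sub_self, Pi.neg_apply] at hev ⊢
        have := h0 x hx (by simpa using hev)
        omega)
      ⟨l.reverse, by simpa using hl.rotate, by simpa using hk⟩
    refine ⟨l'.reverse, ?_, by simpa using hk'⟩
    have := hl'.rotate
    simpa using this

end

/-! ### Slides as sequences of switches -/

/-- The row of a box, as an integer. -/
def boxRow (x : ℕ × ℕ) : ℤ := x.1

/-- The column of a box, as an integer. -/
def boxCol (x : ℕ × ℕ) : ℤ := x.2

namespace IncTableau

theorem eq_or_lt_of_box {x y : ℕ × ℕ} (h1 : boxRow x ≤ boxRow y) (h2 : boxCol x ≤ boxCol y) :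
    x = y ∨ x < y := by
  simp only [boxRow, boxCol] at h1 h2
  exact eq_or_lt_of_le (Prod.le_def.2 ⟨by omega, by omega⟩)

theorem switchStep_sweep (T : IncTableau) (X : Finset (ℕ × ℕ))
    (hX : ∀ x ∈ X, T.IsInnerCorner x) (i : ℕ) (hi : i < T.maxEntry) :
    SwitchStep boxRow boxCol {x | x ∈ T.outer ∧ (x ∈ T.inner → x ∈ X)}
      (fun x => ((sweep (T.withBullets X) i x).rank i : ℤ))
      (fun x => ((sweep (T.withBullets X) (i + 1) x).rank (i + 1) : ℤ)) (2 + 2 * i) := by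
  have hb := T.slideInv_sweep X hX i hi.le
  have ha := T.slideInv_sweep X hX (i + 1) hi
  change SlideInv T X T.maxEntry (i + 1) (switchRibbons (i + 1) (sweep (T.withBullets X) i)) at ha
  change SwitchStep _ _ _ _
    (fun x => ((switchRibbons (i + 1) (sweep (T.withBullets X) i) x).rank (i + 1) : ℤ)) _
  generalize sweep (T.withBullets X) i = f at hb ha ⊢
  have hbl : ∀ x ∈ {x | x ∈ T.outer ∧ (x ∈ T.inner → x ∈ X)}, f x ≠ Mark.blank :=
    fun x hx => (hb.mem_iff x).2 hx
  have hfb : ∀ x ∈ {x | x ∈ T.outer ∧ (x ∈ T.inner → x ∈ X)}, (f x).rank i = 2 * i + 1 →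
      f x = Mark.bullet := by
    intro x hx h1
    cases hf : f x with
    | blank => exact absurd hf (hbl x hx)
    | bullet => rfl
    | label n => rw [hf] at h1; simp only [Mark.rank] at h1; omega
  have hfl : ∀ x ∈ {x | x ∈ T.outer ∧ (x ∈ T.inner → x ∈ X)}, (f x).rank i = 2 * i + 2 →
      f x = Mark.label (i + 1) := by
    intro x hx h1
    cases hf : f x with
    | blank => exact absurd hf (hbl x hx)
    | bullet => rw [hf] at h1; simp only [Mark.rank] at h1; omega
    | label n =>
      rw [hf] at h1; simp only [Mark.rank] at h1
      rw [show n = i + 1 by omega]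
  have hnbr : ∀ x, InRibbons (i + 1) f x →
      switchRibbons (i + 1) f x ≠ f x → ∃ y, BoxAdj x y ∧ InRibbons (i + 1) f y := by
    intro x hx hne
    by_contra hc
    refine hne ?_
    unfold switchRibbons
    rw [if_neg (fun h => hc h.2)]
  have hmem : ∀ y, InRibbons (i + 1) f y →
      y ∈ {x | x ∈ T.outer ∧ (x ∈ T.inner → x ∈ X)} := fun y hy =>
    (hb.mem_iff y).1 (by rcases hy with hy | hy <;> simp [hy])
  refine ⟨⟨i + 1, by ring⟩, ?_, ?_, ?_, ?_, ?_, ?_, ?_⟩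
  -- If the intermediate box is in the inner shape, so is `x`; then `x` is an inner corner from `X`,
  -- and by maximality the two boxes coincide.
  · rintro ⟨x1, x2⟩ hx ⟨y1, y2⟩ hy r c h1 h2 h3 h4
    simp only [boxRow, boxCol] at h1 h2 h3 h4
    lift r to ℕ using by omega
    lift c to ℕ using by omega
    refine ⟨(r, c), ⟨T.outer.up_left_mem (by omega) (by omega) hy.1, fun hz => ?_⟩, rfl, rfl⟩
    have hxz : ((x1, x2) : ℕ × ℕ) ≤ (r, c) := Prod.mk_le_mk.2 ⟨by omega, by omega⟩
    have hxi : (x1, x2) ∈ T.inner := T.inner.isLowerSet hxz hz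
    have h5 := hxz.antisymm ((hX _ (hx.2 hxi)).le_of_ge hz hxz)
    rw [← h5]
    exact hx.2 hxi
  · intro x hx y hy h1 h2
    exact (eq_or_lt_of_box h1 h2).imp id fun h => by
      exact_mod_cast hb.strict x y h (hbl x hx) (hbl y hy)
  · intro x hx y hy h1 h2
    exact (eq_or_lt_of_box h1 h2).imp id fun h => by
      exact_mod_cast ha.strict x y h ((ha.mem_iff x).2 hx) ((ha.mem_iff y).2 hy)
  · intro x hx h1 h2
    have hnb : ¬ InRibbons (i + 1) f x := by
      rintro (h | h)
      · rw [h] at h1; simp only [Mark.rank] at h1; push_cast at h1; omega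
      · rw [h] at h2; simp only [Mark.rank] at h2; push_cast at h2; omega
    have h3 : switchRibbons (i + 1) f x = f x := by
      unfold switchRibbons
      rw [if_neg (fun h => hnb h.1)]
    rw [h3]
    cases hf : f x with
    | blank => exact absurd hf (hbl x hx)
    | bullet => exact absurd (Or.inl hf) hnb
    | label n =>
      simp only [Mark.rank]
      exact ⟨trivial, by push_cast; exact even_two_mul _⟩
  · intro x hx h1
    have h2 : InRibbons (i + 1) f x := by
      rcases h1 with h1 | h1
      · exact Or.inl (hfb x hx (by omega))
      · exact Or.inr (hfl x hx (by omega))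
    rcases switch_cases (i + 1) f x with ⟨-, h | h⟩ | ⟨-, h | h⟩ | ⟨h, -⟩
    · rw [h]; simp only [Mark.rank]; push_cast; omega
    · rw [h]; simp only [Mark.rank]; push_cast; omega
    · rw [h]; simp only [Mark.rank]; push_cast; omega
    · rw [h]; simp only [Mark.rank]; push_cast; omega
    · exact absurd h2 h
  · intro x hx h1 h2
    have hfx := hfl x hx (by omega)
    obtain ⟨y, hxy, hy⟩ := hnbr x (Or.inr hfx) (fun h => by
      rw [h, hfx] at h2; simp only [Mark.rank] at h2; push_cast at h2; omega)
    have hyS := hmem y hy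
    have hry : (f y).rank i = 2 * i + 1 ∨ (f y).rank i = 2 * i + 2 := by
      rcases hy with hy | hy <;> rw [hy]
      · exact Or.inl rfl
      · exact Or.inr rfl
    -- Strictness of ranks forces the neighbour in the ribbon to be northwest of `x` and to be a
    -- bullet.
    have hnlt : ¬ x < y := fun h => by
      have := hb.strict x y h (hbl x hx) (hbl y hyS)
      omega
    have hne : (y < x → (f y).rank i < (f x).rank i) := fun h =>
      hb.strict y x h (hbl y hyS) (hbl x hx)
    obtain ⟨x1, x2⟩ := x
    obtain ⟨y1, y2⟩ := y
    simp only [BoxAdj, Prod.lt_iff] at hxy hnlt hne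
    refine ⟨(y1, y2), hyS, ?_, ?_⟩
    · have := hne (by omega)
      omega
    · simp only [boxRow, boxCol]
      omega
  · intro x hx h1 h2
    have hfx := hfb x hx (by omega)
    obtain ⟨y, hxy, hy⟩ := hnbr x (Or.inl hfx) (fun h => by
      rw [h, hfx] at h2; simp only [Mark.rank] at h2; push_cast at h2; omega)
    have hyS := hmem y hy
    have hxS := (ha.mem_iff x).2 hx
    have hyS' := (ha.mem_iff y).2 hyS
    have hry : (switchRibbons (i + 1) f y).rank (i + 1) = 2 * i + 2 ∨
        (switchRibbons (i + 1) f y).rank (i + 1) = 2 * i + 3 := by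
      rcases switch_cases (i + 1) f y with ⟨-, h | h⟩ | ⟨-, h | h⟩ | ⟨h, -⟩
      · rw [h]; simp only [Mark.rank]; omega
      · rw [h]; simp only [Mark.rank]; omega
      · rw [h]; simp only [Mark.rank]; omega
      · rw [h]; simp only [Mark.rank]; omega
      · exact absurd hy h
    have hnlt : ¬ y < x := fun h => by
      have := ha.strict y x h hyS' hxS
      omega
    have hne := fun h : x < y => ha.strict x y h hxS hyS'
    obtain ⟨x1, x2⟩ := x
    obtain ⟨y1, y2⟩ := y
    simp only [BoxAdj, Prod.lt_iff] at hxy hnlt hne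
    refine ⟨(y1, y2), hyS, ?_, ?_⟩
    · have := hne (by omega)
      omega
    · simp only [boxRow, boxCol]
      omega

/-- The set of filled boxes. -/
def boxes (T : IncTableau) : Set (ℕ × ℕ) := {x | x ∈ T.outer ∧ x ∉ T.inner}

/-- There is a chain of `k` boxes with labels in `[a, b]` that goes strictly east and weakly
north (for `row = boxRow`, `col = boxCol`), or strictly south and weakly west (for
`row = boxCol`, `col = boxRow`). -/
def HasChain (row col : ℕ × ℕ → ℤ) (T : IncTableau) (a b k : ℕ) : Prop :=
  ∃ l, IsRankChain row col T.boxes (2 * a) (2 * b) (fun x => 2 * (T.entry x : ℤ)) l ∧ l.length = k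

theorem mem_boxes_kjdt_iff {T : IncTableau} {X : Finset (ℕ × ℕ)}
    (hX : ∀ x ∈ X, T.IsInnerCorner x) {x : ℕ × ℕ} : x ∈ (T.kjdt X hX).boxes ↔
    (x ∈ T.outer ∧ (x ∈ T.inner → x ∈ X)) ∧ T.slideResult X x ≠ Mark.bullet := by
  simp only [boxes, kjdt, Set.mem_ofPred_eq, ← YoungDiagram.mem_cells, Finset.mem_filter,
    Finset.mem_sdiff]
  tauto

/-- At both ends of the sweep the boxes of even rank are exactly the filled boxes of the tableau, so
rank chains there are chains of labels. Keeping `row` and `col` general lets one argument serve both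
orientations. -/
theorem hasChain_kjdt_iff_of_switchStep {T : IncTableau} {X : Finset (ℕ × ℕ)}
    (hX : ∀ x ∈ X, T.IsInnerCorner x) {row col : ℕ × ℕ → ℤ} {a b k : ℕ}
    (hstep : ∀ i < T.maxEntry,
      SwitchStep row col {x | x ∈ T.outer ∧ (x ∈ T.inner → x ∈ X)}
        (fun x => ((sweep (T.withBullets X) i x).rank i : ℤ))
        (fun x => ((sweep (T.withBullets X) (i + 1) x).rank (i + 1) : ℤ)) (2 + 2 * i)) :
    HasChain row col T a b k ↔ HasChain row col (T.kjdt X hX) a b k := by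
  have hnodd : ∀ m : ℕ, ¬ Even (((2 * m + 1 : ℕ)) : ℤ) := fun m h => by
    push_cast at h; grind
  have h0 : ∀ x ∈ T.boxes, T.withBullets X x = Mark.label (T.entry x) := by
    intro x hx
    unfold withBullets
    rw [if_neg (fun h => hx.2 (hX x h).prop)]
    exact if_pos hx
  have h0' : ∀ x ∈ {x | x ∈ T.outer ∧ (x ∈ T.inner → x ∈ X)},
      Even (((T.withBullets X x).rank 0 : ℕ) : ℤ) → x ∈ T.boxes := by
    intro x hx hev
    refine ⟨hx.1, fun hxi => ?_⟩
    rw [withBullets, if_pos (hx.2 hxi)] at hev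
    exact hnodd 0 hev
  have hinv := T.slideInv_result X hX
  have hm : ∀ x ∈ (T.kjdt X hX).boxes,
      T.slideResult X x = Mark.label ((T.kjdt X hX).entry x) := by
    intro x hx
    rw [mem_boxes_kjdt_iff] at hx
    obtain ⟨n, -, hn⟩ := slideResult_label hX hx.1.1 hx.2 hx.1.2
    change _ = Mark.label (T.slideResult X x).num
    rw [hn]; rfl
  have hm' : ∀ x ∈ {x | x ∈ T.outer ∧ (x ∈ T.inner → x ∈ X)},
      Even (((T.slideResult X x).rank T.maxEntry : ℕ) : ℤ) → x ∈ (T.kjdt X hX).boxes := by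
    intro x hx hev
    rw [mem_boxes_kjdt_iff]
    refine ⟨hx, fun hb => ?_⟩
    rw [hb] at hev
    exact hnodd _ hev
  have key := exists_rankChain_iff (a := 2 * a) (b := 2 * b) (k := k) hstep
    (fun x hx hev => by
      have h1 := h0' x hx hev
      have h2 := T.entry_pos x h1.1 h1.2
      simp only [sweep, h0 x h1, Mark.rank]
      push_cast; omega)
    (fun x hx hev => by
      have h1 := hm x (hm' x hx hev)
      have h2 := (hinv.bound x _ h1).2
      change ((T.slideResult X x).rank _ : ℤ) < _
      simp only [h1, Mark.rank]
      push_cast; omega)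
  have e0 : (∃ l, IsRankChain row col {x | x ∈ T.outer ∧ (x ∈ T.inner → x ∈ X)} (2 * a) (2 * b)
      (fun x => ((sweep (T.withBullets X) 0 x).rank 0 : ℤ)) l ∧ l.length = k) ↔
      HasChain row col T a b k := by
    refine exists_congr fun l => and_congr_left fun _ => ⟨fun h => ?_, fun h => ?_⟩
    · refine h.congr (fun x hx => h0' x (h.2 x hx).1 (h.2 x hx).2.1) fun x hx => ?_
      simp only [sweep, h0 x (h0' x (h.2 x hx).1 (h.2 x hx).2.1), Mark.rank]
      push_cast; rfl
    · refine h.congr (fun x hx => ⟨(h.2 x hx).1.1, fun h' => absurd h' (h.2 x hx).1.2⟩)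
        fun x hx => ?_
      simp only [sweep, h0 x (h.2 x hx).1, Mark.rank]
      push_cast; rfl
  have em : (∃ l, IsRankChain row col {x | x ∈ T.outer ∧ (x ∈ T.inner → x ∈ X)} (2 * a) (2 * b)
      (fun x => ((T.slideResult X x).rank T.maxEntry : ℤ)) l ∧ l.length = k) ↔
      HasChain row col (T.kjdt X hX) a b k := by
    refine exists_congr fun l => and_congr_left fun _ => ⟨fun h => ?_, fun h => ?_⟩
    · refine h.congr (fun x hx => hm' x (h.2 x hx).1 (h.2 x hx).2.1) fun x hx => ?_
      simp only [hm x (hm' x (h.2 x hx).1 (h.2 x hx).2.1), Mark.rank]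
      push_cast; rfl
    · refine h.congr (fun x hx => ((mem_boxes_kjdt_iff hX).1 (h.2 x hx).1).1) fun x hx => ?_
      simp only [hm x (h.2 x hx).1, Mark.rank]
      push_cast; rfl
  exact e0.symm.trans (key.trans em)

/-- Equality of the chain lengths of two tableaux, for every interval of labels. -/
def SameChains (T R : IncTableau) : Prop :=
  ∀ a b k, (HasChain boxRow boxCol T a b k ↔ HasChain boxRow boxCol R a b k) ∧
    (HasChain boxCol boxRow T a b k ↔ HasChain boxCol boxRow R a b k)

theorem IsKRect.sameChains {T R : IncTableau} (h : IsKRect T R) : SameChains T R := by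
  induction h with
  | done T h => exact fun a b k => ⟨Iff.rfl, Iff.rfl⟩
  | slide T R X hne hX h ih =>
    refine fun a b k => ⟨Iff.trans ?_ (ih a b k).1, Iff.trans ?_ (ih a b k).2⟩
    · exact hasChain_kjdt_iff_of_switchStep hX fun i hi => T.switchStep_sweep X hX i hi
    · exact hasChain_kjdt_iff_of_switchStep hX fun i hi =>
        (T.switchStep_sweep X hX i hi).transpose

theorem IsKRect.inner_eq_bot {T R : IncTableau} (h : IsKRect T R) : R.inner = ⊥ := by
  induction h with
  | done T h => exact T.no_innerCorner_iff.1 h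
  | slide T R X hne hX h ih => exact ih

end IncTableau

/-! ### Recognising superstandard tableaux by their chains -/

namespace IncTableau

theorem length_le_of_pairwise_lt {α : Type*} (f : α → ℤ) (n : ℕ) (l : List α)
    (hl : l.Pairwise (fun x y => f x < f y)) (h0 : ∀ x ∈ l, 0 ≤ f x) (hn : ∀ x ∈ l, f x < n) :
    l.length ≤ n := by
  have h1 : (l.map f).Nodup := List.pairwise_map.2 (hl.imp fun h => h.ne)
  have h2 := List.toFinset_card_of_nodup h1
  have h3 : (l.map f).toFinset ⊆ Finset.Ico (0 : ℤ) n := by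
    intro z hz
    obtain ⟨x, hx, rfl⟩ := List.mem_map.1 (List.mem_toFinset.1 hz)
    exact Finset.mem_Ico.2 ⟨h0 x hx, hn x hx⟩
  have h4 := Finset.card_le_card h3
  rw [h2] at h4
  simpa using h4

theorem mem_boxes_of_inner_eq_bot {R : IncTableau} (hR : R.inner = ⊥) {x : ℕ × ℕ} :
    x ∈ R.boxes ↔ x ∈ R.outer := by
  simp [boxes, hR]

theorem _root_.IsRankChain.mem_bounds {R : IncTableau} {row col : ℕ × ℕ → ℤ} {a b : ℕ}
    {l : List (ℕ × ℕ)}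
    (hl : IsRankChain row col R.boxes (2 * a) (2 * b) (fun x => 2 * (R.entry x : ℤ)) l)
    {x : ℕ × ℕ} (hx : x ∈ l) : x ∈ R.boxes ∧ a ≤ R.entry x ∧ R.entry x ≤ b := by
  obtain ⟨h1, -, h2, h3⟩ := hl.2 x hx
  dsimp only at h2 h3
  exact ⟨h1, by omega, by omega⟩

/-- If all labels `≥ a` of a straight tableau lie in rows `≥ r`, then a row chain of such labels
is at most as long as row `r`. -/
theorem HasChain.le_rowLen {R : IncTableau} (hR : R.inner = ⊥) {a b k r : ℕ}
    (h : HasChain boxRow boxCol R a b k)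
    (hr : ∀ x ∈ R.outer, a ≤ R.entry x → r ≤ x.1) : k ≤ R.outer.rowLen r := by
  obtain ⟨l, hl, rfl⟩ := h
  refine length_le_of_pairwise_lt boxCol _ l (hl.1.imp fun h => h.1) (fun x _ => ?_) fun x hx => ?_
  · simp [boxCol]
  · obtain ⟨h1, h2, -⟩ := hl.mem_bounds hx
    rw [mem_boxes_of_inner_eq_bot hR] at h1
    have h3 := hr x h1 h2
    have h4 : (r, x.2) ∈ R.outer := R.outer.up_left_mem h3 le_rfl h1
    rw [YoungDiagram.mem_iff_lt_rowLen] at h4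
    simp only [boxCol]
    exact_mod_cast h4

theorem hasChain_row {R : IncTableau} (hR : R.inner = ⊥) {a b r : ℕ}
    (h : ∀ j < R.outer.rowLen r, a ≤ R.entry (r, j) ∧ R.entry (r, j) ≤ b) :
    HasChain boxRow boxCol R a b (R.outer.rowLen r) := by
  refine ⟨(List.range (R.outer.rowLen r)).map (fun j => (r, j)), ⟨?_, ?_⟩, by simp⟩
  · refine List.pairwise_map.2 (List.pairwise_lt_range.imp_of_mem ?_)
    intro i j _ hj hij
    have h1 := R.row_strict r i j hij (by rw [hR]; exact YoungDiagram.notMem_bot _)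
      (YoungDiagram.mem_iff_lt_rowLen.2 (List.mem_range.1 hj))
    simp only [boxRow, boxCol]
    omega
  · intro x hx
    obtain ⟨j, hj, rfl⟩ := List.mem_map.1 hx
    have hj := List.mem_range.1 hj
    have := h j hj
    exact ⟨(mem_boxes_of_inner_eq_bot hR).2 (YoungDiagram.mem_iff_lt_rowLen.2 hj),
      even_two_mul _, by dsimp only; omega, by dsimp only; omega⟩

/-- The sum of the lengths of the first `r` rows. -/
def rowSum (μ : YoungDiagram) (r : ℕ) : ℕ := ∑ k ∈ Finset.range r, μ.rowLen k

theorem rowSum_succ (μ : YoungDiagram) (r : ℕ) : rowSum μ (r + 1) = rowSum μ r + μ.rowLen r :=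
  Finset.sum_range_succ _ _

theorem rowSum_mono (μ : YoungDiagram) : Monotone (rowSum μ) :=
  fun _ _ h => Finset.sum_le_sum_of_subset (Finset.range_mono h)

theorem superstandard_entry {μ : YoungDiagram} {x : ℕ × ℕ} (hx : x ∈ μ) :
    (superstandard μ).entry x = rowSum μ x.1 + x.2 + 1 :=
  if_pos hx

theorem le_row_of_superstandard {μ : YoungDiagram} {x : ℕ × ℕ} (hx : x ∈ μ) {r : ℕ}
    (h : rowSum μ r + 1 ≤ (superstandard μ).entry x) : r ≤ x.1 := by
  rw [superstandard_entry hx] at h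
  have h1 : x.2 < μ.rowLen x.1 := YoungDiagram.mem_iff_lt_rowLen.1 hx
  have h2 := rowSum_succ μ x.1
  by_contra hc
  have := rowSum_mono μ (show x.1 + 1 ≤ r by omega)
  omega

theorem row_le_of_superstandard {μ : YoungDiagram} {x : ℕ × ℕ} (hx : x ∈ μ) {r : ℕ}
    (h : (superstandard μ).entry x ≤ rowSum μ (r + 1)) : x.1 ≤ r := by
  rw [superstandard_entry hx] at h
  by_contra hc
  have := rowSum_mono μ (show r + 1 ≤ x.1 by omega)
  omega

/-- The induction step, one row: if a straight tableau has the chains of a superstandard tableau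
and its rows from `r` on carry the labels `> μ₁ + ⋯ + μᵣ`, then row `r` is as it should be. -/
theorem row_eq_of_sameChains {R : IncTableau} {μ : YoungDiagram} (hR : R.inner = ⊥)
    (h : SameChains R (superstandard μ)) {r : ℕ}
    (hr : ∀ x ∈ R.outer, r ≤ x.1 ↔ rowSum μ r + 1 ≤ R.entry x) :
    R.outer.rowLen r = μ.rowLen r ∧
      (∀ j < μ.rowLen r, R.entry (r, j) = rowSum μ r + j + 1) ∧
      ∀ x ∈ R.outer, r + 1 ≤ x.1 ↔ rowSum μ (r + 1) + 1 ≤ R.entry x := by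
  have hin : ∀ x, x ∉ R.inner := fun x => by rw [hR]; exact YoungDiagram.notMem_bot x
  have hS : HasChain boxRow boxCol (superstandard μ) (rowSum μ r + 1) (rowSum μ (r + 1))
      (μ.rowLen r) :=
    hasChain_row (R := superstandard μ) (r := r) rfl fun j hj => by
      rw [superstandard_entry (μ := μ) (YoungDiagram.mem_iff_lt_rowLen.2 hj), rowSum_succ]
      have : j < μ.rowLen r := hj
      simp only
      omega
  have hSR := (h _ _ _).1.2 hS
  have hlen : R.outer.rowLen r = μ.rowLen r := by
    refine le_antisymm ?_ (hSR.le_rowLen hR fun x hx hx' => (hr x hx).2 hx')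
    -- The entries of this row are not yet bounded by `rowSum μ (r + 1)`, hence the trivial upper
    -- end `R.maxEntry`.
    have h1 : HasChain boxRow boxCol R (rowSum μ r + 1) R.maxEntry (R.outer.rowLen r) :=
      hasChain_row hR fun j hj => by
        have hx : (r, j) ∈ R.outer := YoungDiagram.mem_iff_lt_rowLen.2 hj
        exact ⟨(hr _ hx).1 le_rfl, Finset.le_sup (f := R.entry) hx⟩
    exact ((h _ _ _).1.1 h1).le_rowLen (R := superstandard μ) rfl
      fun x hx hx' => le_row_of_superstandard hx hx'
  have hmem : ∀ {i}, i < μ.rowLen r → (r, i) ∈ R.outer := fun hi =>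
    YoungDiagram.mem_iff_lt_rowLen.2 (hlen ▸ hi)
  have hgap : ∀ i d, i + d < μ.rowLen r → R.entry (r, i) + d ≤ R.entry (r, i + d) := by
    intro i d
    induction d with
    | zero => intro _; simp
    | succ d ih =>
      intro hd
      have h1 := ih (by omega)
      have h2 := R.row_strict r (i + d) (i + (d + 1)) (by omega) (hin _) (hmem hd)
      omega
  have hrow : ∀ j < μ.rowLen r, R.entry (r, j) = rowSum μ r + j + 1 := by
    intro j hj
    have h0 := (hr (r, 0) (hmem (by omega))).1 le_rfl
    have h1 := hgap 0 j (by omega)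
    rw [Nat.zero_add] at h1
    have h2 := hgap j (μ.rowLen r - 1 - j) (by omega)
    rw [show j + (μ.rowLen r - 1 - j) = μ.rowLen r - 1 by omega] at h2
    -- Once the last entry is bounded, strict increase leaves no slack in the row.
    suffices R.entry (r, μ.rowLen r - 1) ≤ rowSum μ (r + 1) by
      rw [rowSum_succ] at this
      omega
    obtain ⟨l, hl, hk⟩ := hSR
    -- The chain uses `μ.rowLen r` distinct columns, so it reaches this far east. That box is weakly
    -- southeast of the end of row `r` and bounds its entry.
    have hex : ∃ x ∈ l, μ.rowLen r - 1 ≤ x.2 := by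
      by_contra hc
      push Not at hc
      have := length_le_of_pairwise_lt boxCol (μ.rowLen r - 1) l (hl.1.imp fun h => h.1)
        (fun x _ => by simp [boxCol]) (fun x hx => by
          have := hc x hx
          simp only [boxCol]; omega)
      omega
    obtain ⟨⟨x1, x2⟩, hx, hxc⟩ := hex
    obtain ⟨hxS, hx1, hx2⟩ := hl.mem_bounds hx
    rw [mem_boxes_of_inner_eq_bot hR] at hxS
    have hxr := (hr _ hxS).2 hx1
    rcases eq_or_lt_of_le (show ((r, μ.rowLen r - 1) : ℕ × ℕ) ≤ (x1, x2) from ⟨hxr, hxc⟩)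
      with h3 | h3
    · rw [h3]; omega
    · have := R.strict h3 (hin _) hxS
      omega
  refine ⟨hlen, hrow, fun x hx => ⟨fun hx1 => ?_, fun hx1 => ?_⟩⟩
  · by_contra hc
    have hy : (r, x.2) ∈ R.outer := R.outer.up_left_mem (by omega) le_rfl hx
    have hyr := (hr _ hy).1 le_rfl
    have hlt : R.entry (r, x.2) < R.entry x :=
      R.strict (Prod.lt_iff.2 (Or.inl ⟨by simpa using hx1, le_rfl⟩)) (hin _) hx
    -- A small label below row `r` would form a column chain with the box above it in row `r`. In
    -- `superstandard μ` all labels of this interval lie in one row, so no such chain exists.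
    have hch : HasChain boxCol boxRow R (rowSum μ r + 1) (rowSum μ (r + 1)) 2 := by
      refine ⟨[(r, x.2), x], ⟨?_, ?_⟩, rfl⟩
      · simp only [List.pairwise_cons, List.mem_singleton, forall_eq, List.not_mem_nil,
          false_imp_iff, implies_true, List.Pairwise.nil, and_true, boxRow, boxCol]
        omega
      · simp only [List.mem_cons, List.not_mem_nil, or_false, forall_eq_or_imp, forall_eq,
          mem_boxes_of_inner_eq_bot hR]
        exact ⟨⟨hy, even_two_mul _, by omega, by omega⟩, hx, even_two_mul _, by omega, by omega⟩
    obtain ⟨l, hl, hk⟩ := (h _ _ _).2.1 hch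
    obtain ⟨y, z, rfl⟩ := List.length_eq_two.1 hk
    have h1 := hl.1
    obtain ⟨hyS, hy1, hy2⟩ := hl.mem_bounds (x := y) (by simp)
    obtain ⟨hzS, hz1, hz2⟩ := hl.mem_bounds (x := z) (by simp)
    rw [mem_boxes_of_inner_eq_bot rfl] at hyS hzS
    simp only [List.pairwise_cons, List.mem_singleton, forall_eq, boxRow] at h1
    have h2 := le_row_of_superstandard (μ := μ) hyS hy1
    have h3 := row_le_of_superstandard (μ := μ) hzS hz2
    omega
  · have h1 := rowSum_succ μ r
    have h2 := (hr x hx).2 (by omega)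
    by_contra hc
    obtain ⟨x1, x2⟩ := x
    obtain rfl : x1 = r := by simp only at h2 hc; omega
    have h3 : x2 < R.outer.rowLen x1 := YoungDiagram.mem_iff_lt_rowLen.1 hx
    have := hrow x2 (by omega)
    omega

theorem eq_superstandard_of_sameChains {R : IncTableau} {μ : YoungDiagram} (hR : R.inner = ⊥)
    (h : SameChains R (superstandard μ)) : R = superstandard μ := by
  have key : ∀ r, ∀ x ∈ R.outer, r ≤ x.1 ↔ rowSum μ r + 1 ≤ R.entry x := by
    intro r
    induction r with
    | zero =>
      intro x hx
      have := R.entry_pos x hx (by rw [hR]; exact YoungDiagram.notMem_bot x)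
      simp only [rowSum, Finset.range_zero, Finset.sum_empty]
      omega
    | succ r ih => exact (row_eq_of_sameChains hR h ih).2.2
  have hout : R.outer = μ := by
    ext ⟨i, j⟩
    rw [YoungDiagram.mem_cells, YoungDiagram.mem_cells, YoungDiagram.mem_iff_lt_rowLen,
      YoungDiagram.mem_iff_lt_rowLen, (row_eq_of_sameChains hR h (key i)).1]
  refine IncTableau.ext hout hR (funext fun x => ?_)
  by_cases hx : x ∈ μ
  · rw [superstandard_entry hx]
    exact (row_eq_of_sameChains hR h (key x.1)).2.1 x.2 (YoungDiagram.mem_iff_lt_rowLen.1 hx)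
  · rw [R.entry_off x (Or.inl (hout ▸ hx)), (superstandard μ).entry_off x (Or.inl hx)]

end IncTableau

theorem mainTheorem1 (T : IncTableau) (μ : YoungDiagram)
    (h : T.IsKRect (IncTableau.superstandard μ)) :
    ∀ R : IncTableau, T.IsKRect R → R = IncTableau.superstandard μ := by
  intro R hR
  refine IncTableau.eq_superstandard_of_sameChains hR.inner_eq_bot fun a b k => ?_
  exact ⟨(hR.sameChains a b k).1.symm.trans (h.sameChains a b k).1,
    (hR.sameChains a b k).2.symm.trans (h.sameChains a b k).2⟩
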